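/- **Setting.** Let $\Gamma=\{\Omega_k\}_k$ be a finite or countably infinite family of countable sets, and let $\Omega=\bigcup_k\Omega_k$. Let $\mathcal S(\Gamma)$ be the set of functions $w:\Omega\to[0,\infty)$ with $\sum_{g\in\Omega_k}w(g)=1$ for all $k$. Let $\mathcal P^0(\Gamma)$ be the set of functions $w:\Omega\to\{0,1\}$ with $\sum_{g\in\Omega_k}w(g)\le 1$ for all $k$. Let $\mathcal W$ be a linear space of real-valued functions on $\Omega$ with $\mathcal P^0(\Gamma)\subseteq\mathcal W$, and put $\mathcal S(\Gamma,\mathcal W)=\mathcal S(\Gamma)\cap\mathcal W$. Write $\operatorname{ex}A$ for the set of extreme points of $A\subseteq\mathcal W$, and $\overline{\operatorname{conv}}\,A$ for the closure of the convex hull of $A$. Let $\mathcal W'$ be the space of functions $w':\Omega\to\mathbb R$ with $\sum_{g\in\Omega}|w(g)w'(g)|<\infty$ for all $w\in\mathcal W$. **Assumptions.** - **(a)** each $g\in\Omega$ belongs to only finitely many of the sets $\Omega_k$; - **(w)** if $w\in\mathcal W$ and $|\tilde w|\le|w|$ pointwise on $\Omega$, then $\tilde w\in\mathcal W$; - **(a$_2$)**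 there is a finite set $M$ of indices such that either $\Omega=\bigcup_{j\in M}\Omega_j$, or no $\Omega_k$ with $k\notin M$ is contained in the union of finitely many other members $\Omega_j$, $j\ne k$, of the family. **Theorem.** Let $\mathfrak T$ be any locally convex vector space topology on $\mathcal W$ such that - **(w$_1$)** every $\mathfrak T$-continuous linear functional on $\mathcal W$ has the form $w\mapsto\sum_{g\in\Omega}w(g)w'(g)$ with some $w'\in\mathcal W'$; - **(w$_2$)** for every $k$ the functional $w\mapsto\sum_{g\in\Omega_k}w(g)$ is defined (by an absolutely convergent sum) on all of $\mathcal W$ and is $\mathfrak T$-continuous. Then, with the closure taken in $\mathfrak T$: 1. $\mathcal S(\Gamma,\mathcal W)=\{\,w\in\overline{\operatorname{conv}}\,\operatorname{ex}\mathcal S(\Gamma,\mathcal W)\,:\,w\ge 0\,\}$; 2. if the cone $\{w\in\mathcal W: w\ge0\}$ is $\mathfrak T$-closed, then $$\mathcal S(\Gamma,\mathcal W)=\overline{\operatorname{conv}}\,\operatorname{ex}\mathcal S(\Gamma,\mathcal W);$$ 3. in particular, the equality in 2 holds whenever all the evaluations $w\mapsto w(g)$, $g\in\Omega$, are $\mathfrak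 T$-continuous. -/

import Mathlib

open Set

namespace Birkhoff

/-- The set `S(Γ)`: nonnegative functions on `X` whose sum over every member `Γ k` is `1`. -/
def S {X ι : Type*} (Γ : ι → Set X) : Set (X → ℝ) :=
  {w | (∀ g, 0 ≤ w g) ∧ ∀ k, HasSum (fun g : Γ k => w g) 1}

/-- The set `S⁰(Γ)`: nonnegative functions on `X` whose sum over every `Γ k` is at most `1`. -/
def S₀ {X ι : Type*} (Γ : ι → Set X) : Set (X → ℝ) :=
  {w | (∀ g, 0 ≤ w g) ∧
    ∀ k, Summable (fun g : Γ k => w g) ∧ ∑' g : Γ k, w g ≤ 1}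

/-- The set `P⁰(Γ)`: the functions in `S⁰(Γ)` taking only the values `0` and `1`. -/
def P₀ {X ι : Type*} (Γ : ι → Set X) : Set (X → ℝ) :=
  {w | w ∈ S₀ Γ ∧ ∀ g, w g = 0 ∨ w g = 1}

/-- The set `S(Γ, W) = S(Γ) ∩ W`, as a subset of the space `W`. -/
def SW {X ι : Type*} (Γ : ι → Set X) (W : Submodule ℝ (X → ℝ)) : Set W :=
  {w | (w : X → ℝ) ∈ S Γ}

/-- The nonnegative functions in `W`. -/
def nonnegCone {X : Type*} (W : Submodule ℝ (X → ℝ)) : Set W :=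
  {w | ∀ g, 0 ≤ (w : X → ℝ) g}

/-- Every point lies in finitely many members of the family. -/
def PointFinite {X ι : Type*} (Γ : ι → Set X) : Prop :=
  ∀ g, {k | g ∈ Γ k}.Finite

/-- `W` is solid. -/
def IsSolid {X : Type*} (W : Submodule ℝ (X → ℝ)) : Prop :=
  ∀ w ∈ W, ∀ v : X → ℝ, (∀ g, |v g| ≤ |w g|) → v ∈ W

/-- For some finite set `M` of indices, either the members indexed by `M` cover
everything, or no other member lies in the union of finitely many members different from it. -/
def CoverCondition {X ι : Type*} (Γ : ι → Set X) : Prop :=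
  ∃ M : Finset ι, (⋃ j ∈ M, Γ j) = univ ∨
    ∀ k, k ∉ M → ∀ F : Finset ι, k ∉ F → ¬ Γ k ⊆ ⋃ j ∈ F, Γ j

/-- The space `W'` of functions `w'` such that `∑ |w g * w' g| < ∞` for all `w ∈ W`. -/
def summableDual {X : Type*} (W : Submodule ℝ (X → ℝ)) : Set (X → ℝ) :=
  {w' | ∀ w ∈ W, Summable (fun g => |w g * w' g|)}

/-- `T` makes the real vector space `V` a locally convex topological vector space
(not necessarily Hausdorff). -/
structure IsLocallyConvexTopology {V : Type*} [AddCommGroup V] [Module ℝ V]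
    (T : TopologicalSpace V) : Prop where
  isTopologicalAddGroup : @IsTopologicalAddGroup V T _
  continuousSMul : @ContinuousSMul ℝ V _ _ T
  locallyConvexSpace : @LocallyConvexSpace ℝ V _ _ _ _ T

/-- The topological dual of `V` for the topology `T`. -/
def topDual {V : Type*} [AddCommGroup V] [Module ℝ V] (T : TopologicalSpace V) :
    Set (V →ₗ[ℝ] ℝ) :=
  {φ | @Continuous V ℝ T _ φ}

/-- Every continuous linear functional is the pairing with some `w' ∈ W'`. -/
def DualInSummable {X : Type*} (W : Submodule ℝ (X → ℝ)) (T : TopologicalSpace W) : Prop :=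
  ∀ φ ∈ topDual T, ∃ w' ∈ summableDual W, ∀ w : W, φ w = ∑' g, (w : X → ℝ) g * w' g

/-- For each `k` the functional `w ↦ ∑_{g ∈ Γ k} w g` is well defined on `W` and
continuous. -/
def DualHasSums {X ι : Type*} (Γ : ι → Set X) (W : Submodule ℝ (X → ℝ))
    (T : TopologicalSpace W) : Prop :=
  ∀ k, ∃ φ ∈ topDual T, ∀ w : W, HasSum (fun g : Γ k => (w : X → ℝ) g) (φ w)

/-- The closure in the topology `T` of the convex hull of the extreme points of `A`. -/
def closedHullExtreme {V : Type*} [AddCommGroup V] [Module ℝ V] (T : TopologicalSpace V)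
    (A : Set V) : Set V :=
  @closure V T (convexHull ℝ (A.extremePoints ℝ))

end Birkhoff

/-!
The inclusion of the closed hull in `S(Γ, W)` is immediate, since the sums over the members of the
family are continuous. For the other inclusion, by Hahn–Banach and the description of the dual, it
is enough to find, for `w ∈ S(Γ, W)`, `w'` in the summable dual and `ε > 0`, an extreme point `v`
of `S(Γ, W)` with `∑ v w' ≥ ∑ w w' - ε`. Since `S(Γ, W)` need not be compact, nor need extreme
points of `S Γ` belong to `W`, the point `v` is sought on a compact face of `S Γ` consisting of
functions supported in the union of a finite set and two packings, where a packing is a set with at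
most one point in every member. All these functions lie in `W`.

* Summability of `w'` over all packings implies that `w'` has small sums over the packings that
  avoid a finite part `J` of the family (`exists_finset_packing_tsum_le`).
* If `S Γ` is nonempty, the cover condition says that, outside a finite set `M` of indices, no
  member is covered by finitely many others (`CoverCondition.exists_finset`).
* Enlarging `M` by `J`, one replaces `w` by a function `v₀` supported in a finite set `F`, with
  sums equal to `1` over the members in `M` and at most `1` over the others, at a small cost in the
  pairing with `w'` (`S.exists_truncation`).
* Adding points one at a time, for each member outside `M` a point outside finitely many other
  members, completes `v₀` to an element of `S Γ`. The added points form two packings off the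
  members in `M`, so the pairing with `w'` changes little (`exists_completion`).
* The elements of `S Γ` supported in `F` and the added points form a face of `S Γ` that is compact
  for pointwise convergence, since every member contains only finitely many points of this support.
  The functional `u ↦ ∑ g ∈ F, u g * w' g` attains its maximum over the face at an extreme point of
  `S Γ` (`exists_extremePoint_ge`), and the points outside `F` contribute little to the pairing.
-/

namespace Birkhoff

variable {X ι : Type*} {Γ : ι → Set X}

/-! ### Packings -/

/-- A packing is a set of points meeting every member of the family in at most one point.
These are exactly the supports of the elements of `P₀ Γ`. -/
def IsPacking (Γ : ι → Set X) (A : Set X) : Prop :=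
  ∀ k, (A ∩ Γ k).Subsingleton

theorem IsPacking.mono {A B : Set X} (hB : IsPacking Γ B) (h : A ⊆ B) : IsPacking Γ A :=
  fun k => (hB k).anti (inter_subset_inter_left _ h)

theorem isPacking_singleton (g : X) : IsPacking Γ {g} :=
  fun _ => subsingleton_singleton.anti inter_subset_left

theorem IsPacking.indicator_mem_P₀ {A : Set X} (hA : IsPacking Γ A) :
    A.indicator (fun _ => (1 : ℝ)) ∈ P₀ Γ := by
  have h01 : ∀ g, A.indicator (fun _ => (1 : ℝ)) g = 0 ∨ A.indicator (fun _ => (1 : ℝ)) g = 1 :=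
    fun g => by by_cases hg : g ∈ A <;> simp [hg]
  refine ⟨⟨fun g => by rcases h01 g with h | h <;> rw [h]; norm_num, fun k => ?_⟩, h01⟩
  rcases (A ∩ Γ k).eq_empty_or_nonempty with he | ⟨a, haA, hak⟩
  · have h0 : (fun g : Γ k => A.indicator (fun _ => (1 : ℝ)) g) = fun _ => 0 := by
      funext g
      refine indicator_of_notMem (fun hg => ?_) _
      have : (g : X) ∈ A ∩ Γ k := ⟨hg, g.2⟩
      simp [he] at this
    rw [h0]
    exact ⟨summable_zero, by simp⟩
  · have h1 : HasSum (fun g : Γ k => A.indicator (fun _ => (1 : ℝ)) g)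
        (A.indicator (fun _ => (1 : ℝ)) a) := by
      refine hasSum_single (⟨a, hak⟩ : Γ k) fun g hg => indicator_of_notMem (fun hgA => hg ?_) _
      exact Subtype.ext (hA k ⟨hgA, g.2⟩ ⟨haA, hak⟩)
    rw [indicator_of_mem haA] at h1
    exact ⟨h1.summable, h1.tsum_eq.le⟩

theorem PointFinite.finite_touched (ha : PointFinite Γ) {F : Set X} (hF : F.Finite) :
    {k | ∃ g ∈ F, g ∈ Γ k}.Finite := by
  have : {k | ∃ g ∈ F, g ∈ Γ k} = ⋃ g ∈ F, {k | g ∈ Γ k} := by ext; simp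
  rw [this]
  exact hF.biUnion fun g _ => ha g

/-- A nonnegative function that is summable over every packing has uniformly small sums over the
packings that avoid a suitable finite part of the family. Otherwise there would be infinitely many
finite packings, no two of which meet a common member of the family, with sums bounded below;
their union would be a packing with infinite sum. -/
theorem exists_finset_packing_tsum_le (hunion : (⋃ k, Γ k) = univ) (ha : PointFinite Γ)
    {f : X → ℝ} (hf : ∀ A, IsPacking Γ A → Summable (A.indicator f))
    {ε : ℝ} (hε : 0 < ε) :
    ∃ J : Finset ι, ∀ A, IsPacking Γ A → (∀ j ∈ J, Disjoint A (Γ j)) →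
      ∑' g, A.indicator f g ≤ ε := by
  classical
  by_contra! hcon
  obtain ⟨s, hs, hr⟩ := exists_seq_of_forall_finset_exists
    (fun B : Finset X => IsPacking Γ (B : Set X) ∧ ε < ∑ g ∈ B, f g)
    (fun B C => ∀ k, (∃ g ∈ B, g ∈ Γ k) → Disjoint (C : Set X) (Γ k)) (by
      intro 𝒮 _
      have hfin : {k | ∃ g ∈ ((𝒮.biUnion id : Finset X) : Set X), g ∈ Γ k}.Finite :=
        ha.finite_touched (Finset.finite_toSet _)
      obtain ⟨A, hA, hAd, hAs⟩ := hcon hfin.toFinset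
      obtain ⟨t, ht⟩ : ∃ t : Finset X, ε < ∑ g ∈ t, A.indicator f g :=
        ((hf A hA).hasSum.eventually_const_lt hAs).exists
      refine ⟨t.filter (· ∈ A), ⟨hA.mono fun g hg => by simp at hg; exact hg.2, ?_⟩, ?_⟩
      · rwa [Finset.sum_filter]
      · rintro B hB k ⟨g, hgB, hgk⟩
        refine (hAd k ?_).mono_left fun g hg => by simp at hg; exact hg.2
        rw [Set.Finite.mem_toFinset]
        exact ⟨g, Finset.mem_coe.2 (Finset.mem_biUnion.2 ⟨B, hB, hgB⟩), hgk⟩)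
  have hU : IsPacking Γ (⋃ n, (s n : Set X)) := by
    rintro k x ⟨hx, hxk⟩ y ⟨hy, hyk⟩
    obtain ⟨m, hm⟩ := mem_iUnion.1 hx
    obtain ⟨n, hn⟩ := mem_iUnion.1 hy
    rcases lt_trichotomy m n with h | h | h
    · exact ((hr m n h k ⟨x, hm, hxk⟩).le_bot ⟨hn, hyk⟩).elim
    · subst h
      exact (hs m).1 k ⟨hm, hxk⟩ ⟨hn, hyk⟩
    · exact ((hr n m h k ⟨y, hn, hyk⟩).le_bot ⟨hm, hxk⟩).elim
  obtain ⟨t, ht⟩ := summable_iff_vanishing_norm.1 (hf _ hU) ε hε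
  have hmeet : ∀ n, ∃ g ∈ s n, g ∈ t := by
    intro n
    by_contra! h
    have h1 := ht (s n) (Finset.disjoint_left.2 h)
    have h2 : ∑ g ∈ s n, (⋃ n, (s n : Set X)).indicator f g = ∑ g ∈ s n, f g :=
      Finset.sum_congr rfl fun g hg => indicator_of_mem (mem_iUnion.2 ⟨n, hg⟩) _
    rw [h2] at h1
    exact absurd ((le_abs_self _).trans_lt h1) (hs n).2.not_gt
  choose x hxs hxt using hmeet
  have hne : ∀ m n, m < n → x m ≠ x n := by
    intro m n hmn he
    obtain ⟨k, hk⟩ := mem_iUnion.1 (hunion.symm ▸ mem_univ (x m) : x m ∈ ⋃ k, Γ k)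
    exact (hr m n hmn k ⟨_, hxs m, hk⟩).le_bot ⟨hxs n, he ▸ hk⟩
  have hinj : Function.Injective fun n => (⟨x n, hxt n⟩ : t) := by
    intro m n h
    have h' : x m = x n := congrArg Subtype.val h
    rcases lt_trichotomy m n with hlt | heq | hlt
    · exact (hne _ _ hlt h').elim
    · exact heq
    · exact (hne _ _ hlt h'.symm).elim
  exact not_injective_infinite_finite _ hinj

/-! ### Sums over members of the family -/

theorem hasSum_member_iff {w : X → ℝ} {k : ι} {a : ℝ} :
    HasSum (fun g : Γ k => w g) a ↔ HasSum ((Γ k).indicator w) a :=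
  hasSum_subtype_iff_indicator

theorem S.hasSum {w : X → ℝ} (hw : w ∈ S Γ) (k : ι) : HasSum ((Γ k).indicator w) 1 :=
  hasSum_member_iff.1 (hw.2 k)

theorem S.le_one (hunion : (⋃ k, Γ k) = univ) {w : X → ℝ} (hw : w ∈ S Γ) (g : X) : w g ≤ 1 := by
  obtain ⟨k, hk⟩ := mem_iUnion.1 (hunion.symm ▸ mem_univ g : g ∈ ⋃ k, Γ k)
  exact le_hasSum (hw.2 k) ⟨g, hk⟩ fun j _ => hw.1 j

theorem S.summable_indicator_biUnion {w : X → ℝ} (hw : w ∈ S Γ) (M : Finset ι) :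
    Summable ((⋃ k ∈ M, Γ k).indicator w) := by
  classical
  have hs : Summable fun g => ∑ k ∈ M, (Γ k).indicator w g :=
    summable_sum fun k _ => (S.hasSum hw k).summable
  have hnn : ∀ k g, 0 ≤ (Γ k).indicator w g := fun k => indicator_nonneg fun g _ => hw.1 g
  refine hs.of_nonneg_of_le (indicator_nonneg fun g _ => hw.1 g) fun g => ?_
  by_cases hg : g ∈ ⋃ k ∈ M, Γ k
  · rw [indicator_of_mem hg]
    obtain ⟨k, hkM, hk⟩ := mem_iUnion₂.1 hg
    exact (indicator_of_mem hk w).symm.le.trans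
      (Finset.single_le_sum (f := fun k => (Γ k).indicator w g) (fun j _ => hnn j g) hkM)
  · rw [indicator_of_notMem hg]
    exact Finset.sum_nonneg fun j _ => hnn j g

/-- Outside the members touching a suitable finite set, every member of the family has small mass
inside a finite union of members. -/
theorem S.exists_finset_touched (ha : PointFinite Γ) {w : X → ℝ} (hw : w ∈ S Γ) (M : Finset ι)
    {ε : ℝ} (hε : 0 < ε) :
    ∃ N : Finset ι, ∀ k ∉ N, ∀ F : Finset X,
      ∑ g ∈ F, (⋃ j ∈ M, Γ j).indicator ((Γ k).indicator w) g ≤ ε := by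
  classical
  set U := ⋃ j ∈ M, Γ j
  obtain ⟨s, hs⟩ := summable_iff_vanishing_norm.1 (S.summable_indicator_biUnion hw M) ε hε
  have hfin := ha.finite_touched s.finite_toSet
  refine ⟨hfin.toFinset, fun k hk F => ?_⟩
  rw [Set.Finite.mem_toFinset] at hk
  have hle : ∑ g ∈ F, U.indicator ((Γ k).indicator w) g ≤ ∑ g ∈ F \ s, U.indicator w g := by
    rw [← Finset.sum_subset (Finset.sdiff_subset (s := F) (t := s))]
    · refine Finset.sum_le_sum fun g _ => indicator_le_indicator ?_
      exact indicator_le_self' (fun g _ => hw.1 g) g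
    · intro g hgF hg
      have hgs : g ∈ s := by simpa [hgF] using hg
      have : g ∉ Γ k := fun h => hk ⟨g, hgs, h⟩
      by_cases hgU : g ∈ U <;> simp [hgU, this]
  exact hle.trans ((le_abs_self _).trans (hs (F \ s) Finset.sdiff_disjoint).le)

/-- If `S Γ` is nonempty, then a finite subfamily can cover everything only when the index set is
finite, so the first alternative of the cover condition is a special case of the second. -/
theorem CoverCondition.exists_finset (ha : PointFinite Γ) (h : CoverCondition Γ) {w : X → ℝ}
    (hw : w ∈ S Γ) :
    ∃ M : Finset ι, ∀ k, k ∉ M → ∀ F : Finset ι, k ∉ F → ¬ Γ k ⊆ ⋃ j ∈ F, Γ j := by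
  obtain ⟨M, hM | hM⟩ := h
  · obtain ⟨N, hN⟩ := S.exists_finset_touched ha hw M (by norm_num : (0 : ℝ) < 1 / 2)
    refine ⟨N, fun k hk => ?_⟩
    have h1 := le_of_tendsto (S.hasSum hw k) (Filter.Eventually.of_forall fun F => by
      have := hN k hk F
      rwa [hM, indicator_univ] at this)
    norm_num at h1
  · exact ⟨M, hM⟩

/-! ### Truncation to finite support -/

/-- A choice of finitely many representatives for the types of points with respect to a finite
subfamily, the type of a point being the set of members of the subfamily containing it. -/
theorem exists_representatives (Γ : ι → Set X) (M : Finset ι) :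
    ∃ (ρ : X → X) (R : Finset X), (∀ g, ρ g ∈ R) ∧ ∀ g, ∀ k ∈ M, (ρ g ∈ Γ k ↔ g ∈ Γ k) := by
  classical
  let τ : X → Finset ι := fun g => M.filter fun k => g ∈ Γ k
  have hτ : (range τ).Finite := by
    refine M.powerset.finite_toSet.subset ?_
    rintro _ ⟨g, rfl⟩
    exact Finset.mem_coe.2 (Finset.mem_powerset.2 (Finset.filter_subset _ _))
  have := hτ.to_subtype
  have hsurj := rangeFactorization_surjective (f := τ)
  refine ⟨fun g => Function.surjInv hsurj (rangeFactorization τ g),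
    (finite_range (Function.surjInv hsurj)).toFinset, fun g => ?_, fun g k hk => ?_⟩
  · simp
  · have h := congrArg Subtype.val (Function.surjInv_eq hsurj (rangeFactorization τ g))
    have h' : τ (Function.surjInv hsurj (rangeFactorization τ g)) = τ g := h
    have h2 := Finset.ext_iff.1 h' k
    simpa [τ, hk] using h2

/-- Every element of `S Γ` can be replaced, with little change in the pairing with a given function,
by a finitely supported nonnegative function whose sums over the members are at most `1`, and
exactly `1` over the members with index in a given finite set `M`.

To restore the sums over `M` after cutting down to a finite set `F`, the mass lost in
`U = ⋃ k ∈ M, Γ k` is moved to representatives of the same type with respect to a larger finite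
subfamily `N`. Members outside `N` have mass at most `1 / 2` in `U`, so that multiplying the
function by `1 - δ` off `U` makes room for the mass moved into them. -/
theorem S.exists_truncation (ha : PointFinite Γ) {w : X → ℝ} (hw : w ∈ S Γ) (M : Finset ι)
    {w' : X → ℝ} (hw' : Summable fun g => |w g * w' g|) {ε : ℝ} (hε : 0 < ε) :
    ∃ (F : Finset X) (v : X → ℝ), (∀ g, 0 ≤ v g) ∧ (∀ g ∉ F, v g = 0) ∧
      (∀ k, ∑ g ∈ F, (Γ k).indicator v g ≤ 1) ∧ (∀ k ∈ M, ∑ g ∈ F, (Γ k).indicator v g = 1) ∧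
      ∑' g, w g * w' g - ε ≤ ∑ g ∈ F, v g * w' g := by
  classical
  set U : Set X := ⋃ j ∈ M, Γ j with hU
  set u : X → ℝ := U.indicator w with hu
  have hus : Summable u := S.summable_indicator_biUnion hw M
  have hu0 : ∀ g, 0 ≤ u g := indicator_nonneg fun g _ => hw.1 g
  have huw : ∀ g, u g ≤ w g := indicator_le_self' fun g _ => hw.1 g
  obtain ⟨N, hN⟩ := S.exists_finset_touched ha hw M (by norm_num : (0 : ℝ) < 1 / 2)
  obtain ⟨ρ, R, hρR, hρ⟩ := exists_representatives Γ (M ∪ N)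
  let χ : ι → X → ℝ := fun k => (Γ k).indicator fun _ => 1
  have hχ0 : ∀ k g, 0 ≤ χ k g := fun k => indicator_nonneg fun _ _ => zero_le_one
  have hχ1 : ∀ k g, χ k g ≤ 1 := fun k => indicator_le_self' fun _ _ => zero_le_one
  have hχ : ∀ k (z : X → ℝ) g, (Γ k).indicator z g = z g * χ k g := by
    intro k z g
    by_cases hg : g ∈ Γ k <;> simp [χ, hg]
  have hwk : ∀ k, HasSum (fun g => w g * χ k g) 1 := fun k => by
    have := S.hasSum hw k
    rwa [show (Γ k).indicator w = fun g => w g * χ k g from funext (hχ k w)] at this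
  set K : ℝ := ∑' g, |w g * w' g| with hK
  have hK0 : 0 ≤ K := tsum_nonneg fun _ => abs_nonneg _
  set C : ℝ := ∑ r ∈ R, |w' r| with hC
  have hC0 : 0 ≤ C := Finset.sum_nonneg fun _ _ => abs_nonneg _
  obtain ⟨δ, hδ0, hδ1, hδK⟩ : ∃ δ : ℝ, 0 < δ ∧ δ ≤ 1 ∧ δ * K ≤ ε / 3 := by
    refine ⟨min 1 (ε / 3 / (K + 1)), by positivity, min_le_left _ _, ?_⟩
    calc min 1 (ε / 3 / (K + 1)) * K ≤ ε / 3 / (K + 1) * (K + 1) := by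
          gcongr
          · exact min_le_right _ _
          · linarith
      _ = ε / 3 := by field_simp
  obtain ⟨θ, hθ0, hθδ, hθC⟩ : ∃ θ : ℝ, 0 < θ ∧ θ ≤ δ / 2 ∧ θ * C ≤ ε / 3 := by
    refine ⟨min (δ / 2) (ε / 3 / (C + 1)), by positivity, min_le_left _ _, ?_⟩
    calc min (δ / 2) (ε / 3 / (C + 1)) * C ≤ ε / 3 / (C + 1) * (C + 1) := by
          gcongr
          · exact min_le_right _ _
          · linarith
      _ = ε / 3 := by field_simp
  obtain ⟨F, hRF, hFu, hFw⟩ : ∃ F : Finset X, R ⊆ F ∧ ∑' g, u g - θ < ∑ g ∈ F, u g ∧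
      ∑' g, w g * w' g - ε / 3 < ∑ g ∈ F, w g * w' g :=
    ((Filter.eventually_ge_atTop R).and
      ((hus.hasSum.eventually_const_lt (by linarith)).and
        (hw'.of_abs.hasSum.eventually_const_lt (by linarith)))).exists
  let ur : X → X → ℝ := fun r g => if ρ g = r then u g else 0
  have hur0 : ∀ r g, 0 ≤ ur r g := fun r g => by
    by_cases h : ρ g = r <;> simp [ur, h, hu0 g]
  have hurs : ∀ r, Summable (ur r) := fun r =>
    hus.of_nonneg_of_le (hur0 r) fun g => by by_cases h : ρ g = r <;> simp [ur, h, hu0 g]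
  -- the mass of `u` lost outside `F` at the points represented by `r`
  let m : X → ℝ := fun r => ∑' g, ur r g - ∑ g ∈ F, ur r g
  have hm0 : ∀ r, 0 ≤ m r := fun r =>
    sub_nonneg.2 ((hurs r).sum_le_tsum F fun g _ => hur0 r g)
  have hmf : ∀ f : X → ℝ,
      ∑ r ∈ R, m r * f r = ∑' g, u g * f (ρ g) - ∑ g ∈ F, u g * f (ρ g) := by
    intro f
    have hpt : ∀ g, ∑ r ∈ R, ur r g * f r = u g * f (ρ g) := by
      intro g
      simp only [ur, ite_mul, zero_mul]
      rw [Finset.sum_ite_eq, if_pos (hρR g)]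
    simp only [← hpt]
    rw [Summable.tsum_finsetSum fun r _ => (hurs r).mul_right (f r), Finset.sum_comm,
      ← Finset.sum_sub_distrib]
    refine Finset.sum_congr rfl fun r _ => ?_
    rw [tsum_mul_right, ← Finset.sum_mul, ← sub_mul]
  have hmθ : ∑ r ∈ R, m r ≤ θ := by
    have := hmf fun _ => 1
    simp only [mul_one] at this
    rw [this]
    linarith
  have hmχ : ∀ k ∈ M ∪ N,
      ∑ r ∈ R, m r * χ k r = ∑' g, u g * χ k g - ∑ g ∈ F, u g * χ k g := by
    intro k hk
    have : ∀ g, χ k (ρ g) = χ k g := fun g => by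
      by_cases h : g ∈ Γ k <;> simp [χ, h, hρ g k hk]
    rw [hmf]
    simp only [this]
  let v : X → ℝ := fun g =>
    (if g ∈ F then w g - δ * (w g - u g) else 0) + if g ∈ R then m g else 0
  have hv : ∀ f : X → ℝ, ∑ g ∈ F, v g * f g =
      ∑ g ∈ F, w g * f g - δ * (∑ g ∈ F, w g * f g - ∑ g ∈ F, u g * f g) +
        ∑ r ∈ R, m r * f r := by
    intro f
    simp only [v, add_mul, ite_mul, zero_mul, Finset.sum_add_distrib]
    congr 1
    · rw [← Finset.sum_sub_distrib, Finset.mul_sum, ← Finset.sum_sub_distrib]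
      refine Finset.sum_congr rfl fun g hg => ?_
      rw [if_pos hg]
      ring
    · rw [Finset.sum_ite_mem, Finset.inter_eq_right.2 hRF]
  refine ⟨F, v, fun g => ?_, fun g hg => ?_, fun k => ?_, fun k hk => ?_, ?_⟩
  · refine add_nonneg ?_ ?_
    · split_ifs
      · nlinarith [hu0 g, huw g]
      · exact le_rfl
    · split_ifs
      exacts [hm0 g, le_rfl]
  · have hgR : g ∉ R := fun h => hg (hRF h)
    simp [v, hg, hgR]
  · have huF : ∑ g ∈ F, u g * χ k g ≤ ∑ g ∈ F, w g * χ k g :=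
      Finset.sum_le_sum fun g _ => mul_le_mul_of_nonneg_right (huw g) (hχ0 k g)
    have hwF : ∑ g ∈ F, w g * χ k g ≤ 1 :=
      sum_le_hasSum F (fun g _ => mul_nonneg (hw.1 g) (hχ0 k g)) (hwk k)
    simp only [hχ k v]
    rw [hv]
    by_cases hk : k ∈ M ∪ N
    · rw [hmχ k hk]
      have huk : Summable fun g => u g * χ k g :=
        (hwk k).summable.of_nonneg_of_le (fun g => mul_nonneg (hu0 g) (hχ0 k g))
          fun g => mul_le_mul_of_nonneg_right (huw g) (hχ0 k g)
      have hrest := ((hwk k).sub huk.hasSum)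
      have := sum_le_hasSum F (fun g _ => sub_nonneg.2
        (mul_le_mul_of_nonneg_right (huw g) (hχ0 k g))) hrest
      rw [Finset.sum_sub_distrib] at this
      nlinarith
    · have h1 : ∑ g ∈ F, u g * χ k g ≤ 1 / 2 := by
        refine le_trans (Finset.sum_le_sum fun g _ => le_of_eq ?_)
          (hN k (fun h => hk (Finset.mem_union_right _ h)) F)
        rw [← hU, ← hχ k u, hu, indicator_indicator, indicator_indicator, inter_comm]
      have h2 : ∑ r ∈ R, m r * χ k r ≤ ∑ r ∈ R, m r :=
        Finset.sum_le_sum fun r _ => mul_le_of_le_one_right (hm0 r) (hχ1 k r)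
      nlinarith
  · have huk : (fun g => u g * χ k g) = fun g => w g * χ k g := by
      funext g
      by_cases hg : g ∈ Γ k
      · rw [hu, indicator_of_mem (mem_iUnion₂.2 ⟨k, hk, hg⟩)]
      · simp [χ, hg]
    simp only [hχ k v]
    rw [hv, hmχ k (Finset.mem_union_left _ hk), huk, (hwk k).tsum_eq]
    ring
  · rw [hv]
    have h1 : δ * (∑ g ∈ F, w g * w' g - ∑ g ∈ F, u g * w' g) ≤ δ * K := by
      gcongr
      rw [← Finset.sum_sub_distrib]
      refine le_trans (Finset.sum_le_sum fun g _ => ?_)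
        (hw'.sum_le_tsum F fun g _ => abs_nonneg _)
      rw [← sub_mul, abs_mul]
      refine (le_abs_self _).trans ?_
      rw [abs_mul]
      gcongr 1
      rw [abs_of_nonneg (sub_nonneg.2 (huw g)), abs_of_nonneg (hw.1 g)]
      linarith [hu0 g]
    have h2 : -(θ * C) ≤ ∑ r ∈ R, m r * w' r := by
      have : ∑ r ∈ R, m r * (-w' r) ≤ θ * C := by
        calc ∑ r ∈ R, m r * (-w' r) ≤ ∑ r ∈ R, m r * C := by
              refine Finset.sum_le_sum fun r hr => mul_le_mul_of_nonneg_left ?_ (hm0 r)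
              exact (neg_le_abs _).trans
                (Finset.single_le_sum (f := fun r => |w' r|) (fun _ _ => abs_nonneg _) hr)
          _ = (∑ r ∈ R, m r) * C := (Finset.sum_mul _ _ _).symm
          _ ≤ θ * C := mul_le_mul_of_nonneg_right hmθ hC0
      simp only [mul_neg, Finset.sum_neg_distrib] at this
      linarith
    linarith

/-! ### Completion of finitely supported functions -/

/-- Construction of a function by well-founded recursion, each value being chosen subject to a
condition on the earlier values. -/
theorem exists_forall_of_wellFounded {α β : Type*} {r : α → α → Prop} (hr : WellFounded r)
    (P : (a : α) → (∀ b, r b a → β) → β → Prop) (h : ∀ a f, ∃ y, P a f y) :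
    ∃ f : α → β, ∀ a, P a (fun b _ => f b) (f a) := by
  choose G hG using h
  refine ⟨hr.fix G, fun a => ?_⟩
  have := hG a fun b _ => hr.fix G b
  rwa [← hr.fix_eq G a] at this

/-- The points used for completion. For each `k ∉ M` a point of `Γ k` is chosen that avoids every
other member which has an index in `M`, or touches `F`, or has an earlier index, or contains a
point chosen earlier. -/
theorem exists_completing_points [Countable ι] (ha : PointFinite Γ) (M : Finset ι)
    (hM : ∀ k, k ∉ M → ∀ F : Finset ι, k ∉ F → ¬ Γ k ⊆ ⋃ j ∈ F, Γ j) (F : Finset X) :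
    ∃ (e : {k // k ∉ M} → ℕ) (q : {k // k ∉ M} → X), Function.Injective e ∧
      ∀ k, q k ∈ Γ k.1 ∧ (∀ j ∈ M, q k ∉ Γ j) ∧
        (∀ j, j ≠ k.1 → (∃ g ∈ F, g ∈ Γ j) → q k ∉ Γ j) ∧
        (∀ i, e i < e k → q k ∉ Γ i) ∧
        ∀ i, e i < e k → ∀ j, j ≠ k.1 → q i ∈ Γ j → q k ∉ Γ j := by
  classical
  obtain ⟨e, he⟩ := exists_injective_nat {k // k ∉ M}
  have hwf : WellFounded fun i k => e i < e k := InvImage.wf e wellFounded_lt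
  obtain ⟨q, hq⟩ := exists_forall_of_wellFounded hwf
    (fun k (f : ∀ i, e i < e k → X) y => y ∈ Γ k ∧ (∀ j ∈ M, y ∉ Γ j) ∧
        (∀ j, j ≠ k.1 → (∃ g ∈ F, g ∈ Γ j) → y ∉ Γ j) ∧
        (∀ i, e i < e k → y ∉ Γ i) ∧
        ∀ i (h : e i < e k), ∀ j, j ≠ k.1 → f i h ∈ Γ j → y ∉ Γ j) (by
      intro k f
      have hlt : {i | e i < e k}.Finite := (finite_Iio (e k)).preimage he.injOn
      have := hlt.to_subtype
      have h1 := ha.finite_touched F.finite_toSet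
      have h2 : (Subtype.val '' {i | e i < e k}).Finite := hlt.image _
      have h3 := ha.finite_touched (finite_range fun i : {i | e i < e k} => f i i.2)
      set J := (M ∪ h1.toFinset ∪ h2.toFinset ∪ h3.toFinset).erase k.1 with hJ
      obtain ⟨y, hyk, hy⟩ := not_subset.1 (hM k k.2 J (Finset.notMem_erase _ _))
      have hy' : ∀ j, j ≠ k.1 → (j ∈ M ∨ j ∈ h1.toFinset) ∨ j ∈ h2.toFinset ∨ j ∈ h3.toFinset →
          y ∉ Γ j := by
        intro j hjk hj hyj
        refine hy (mem_iUnion₂.2 ⟨j, ?_, hyj⟩)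
        simp only [hJ, Finset.mem_erase, Finset.mem_union]
        tauto
      refine ⟨y, hyk, fun j hj => ?_, fun j hjk hj => ?_, fun i hi => ?_, fun i hi j hjk hj => ?_⟩
      · exact hy' j (fun h => k.2 (h ▸ hj)) (Or.inl (Or.inl hj))
      · exact hy' j hjk (Or.inl (Or.inr (h1.mem_toFinset.2 hj)))
      · refine hy' i (fun h => ?_) (Or.inr (Or.inl (h2.mem_toFinset.2 ⟨i, hi, rfl⟩)))
        rw [Subtype.ext h] at hi
        exact lt_irrefl _ hi
      · exact hy' j hjk (Or.inr (Or.inr (h3.mem_toFinset.2 ⟨_, ⟨⟨i, hi⟩, rfl⟩, hj⟩))))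
  exact ⟨e, q, he, hq⟩

/-- A finitely supported nonnegative function `v` with sums at most `1`, and equal to `1` over the
members with index in `M`, is completed to an element of `S Γ` by adding a function supported in
the union of two packings off `⋃ j ∈ M, Γ j`. The two packings do not depend on `v`, but only on a
finite set containing its support.

Every member contains at most two of the completing points: its own point and at most one point
chosen earlier, and the latter only if the member does not touch `F`. This bounds the added values,
and it shows that the completing points can be coloured with two colours such that no member
contains two points of the same colour. -/
theorem exists_completion [Countable ι] (ha : PointFinite Γ) (M : Finset ι)
    (hM : ∀ k, k ∉ M → ∀ F : Finset ι, k ∉ F → ¬ Γ k ⊆ ⋃ j ∈ F, Γ j) (F : Finset X) :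
    ∃ A : Bool → Set X, (∀ b, IsPacking Γ (A b)) ∧ (∀ b, ∀ j ∈ M, Disjoint (A b) (Γ j)) ∧
      Disjoint (A true) (A false) ∧
      ∀ v : X → ℝ, (∀ g, 0 ≤ v g) → (∀ g ∉ F, v g = 0) →
        (∀ k, ∑ g ∈ F, (Γ k).indicator v g ≤ 1) → (∀ k ∈ M, ∑ g ∈ F, (Γ k).indicator v g = 1) →
        ∃ z : X → ℝ, (∀ g, 0 ≤ z g) ∧ (∀ g, z g ≤ 1) ∧ (∀ g ∉ A true ∪ A false, z g = 0) ∧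
          v + z ∈ S Γ := by
  classical
  obtain ⟨e, q, he, hq⟩ := exists_completing_points ha M hM F
  have hwf : WellFounded fun i k => e i < e k := InvImage.wf e wellFounded_lt
  have hlt_or : ∀ i k, i ≠ k → e i < e k ∨ e k < e i := fun i k h => lt_or_gt_of_ne (he.ne h)
  have hqinj : Function.Injective q := by
    intro i k hik
    by_contra hne
    rcases hlt_or i k hne with h | h
    · exact (hq k).2.2.2.1 i h (hik ▸ (hq i).1)
    · exact (hq i).2.2.2.1 k h (hik ▸ (hq k).1)
  -- a foreign point in `Γ k` was chosen before the point belonging to `k`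
  have hearlier : ∀ i k, i ≠ k → q i ∈ Γ k.1 → e i < e k := by
    intro i k hik hi
    rcases hlt_or i k hik with h | h
    · exact h
    · exact ((hq i).2.2.2.1 k h hi).elim
  have hunique : ∀ i j k, i ≠ k → j ≠ k → q i ∈ Γ k.1 → q j ∈ Γ k.1 → i = j := by
    intro i j k hik hjk hi hj
    by_contra hne
    rcases hlt_or i j hne with h | h
    · exact (hq j).2.2.2.2 i h k (fun h => hjk (Subtype.ext h.symm)) hi hj
    · exact (hq i).2.2.2.2 j h k (fun h => hik (Subtype.ext h.symm)) hj hi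
  obtain ⟨col, hcol⟩ := exists_forall_of_wellFounded hwf
    (fun k (f : ∀ i, e i < e k → Bool) b => ∀ i (h : e i < e k), q i ∈ Γ k.1 → b ≠ f i h) (by
      intro k f
      by_cases hex : ∃ i, ∃ _ : e i < e k, q i ∈ Γ k.1
      · obtain ⟨i, hi, hqi⟩ := hex
        refine ⟨!f i hi, fun j hj hqj => ?_⟩
        have : i = j := hunique i j k (fun h => by simp [h] at hi) (fun h => by simp [h] at hj)
          hqi hqj
        subst this
        simp
      · exact ⟨true, fun i hi hqi => (hex ⟨i, hi, hqi⟩).elim⟩)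
  refine ⟨fun b => q '' {k | col k = b}, ?_, ?_, ?_, ?_⟩
  · rintro b k _ ⟨⟨i, hi, rfl⟩, hik⟩ _ ⟨⟨j, hj, rfl⟩, hjk⟩
    by_cases hk : k ∈ M
    · exact ((hq i).2.1 k hk hik).elim
    by_contra hne
    have hij : i ≠ j := fun h => hne (h ▸ rfl)
    have hcb : col i = col j := hi.trans hj.symm
    by_cases h1 : i = ⟨k, hk⟩
    · subst h1
      exact hcol _ j (hearlier j _ hij.symm hjk) hjk hcb
    · by_cases h2 : j = ⟨k, hk⟩
      · subst h2
        exact hcol _ i (hearlier i _ hij hik) hik hcb.symm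
      · exact hij (hunique i j _ h1 h2 hik hjk)
  · rintro b j hj
    refine disjoint_left.2 ?_
    rintro _ ⟨i, -, rfl⟩ hij
    exact (hq i).2.1 j hj hij
  · refine disjoint_left.2 ?_
    rintro _ ⟨i, hi, rfl⟩ ⟨j, hj, hji⟩
    rw [hqinj hji] at hj
    exact Bool.noConfusion (hi.symm.trans hj)
  intro v hv0 hvF hv1 hvM
  have hN : ∀ k, {i | e i < e k}.Finite := fun k => (finite_Iio (e k)).preimage he.injOn
  obtain ⟨c, hc⟩ := exists_forall_of_wellFounded hwf
    (fun k (f : ∀ i, e i < e k → ℝ) y => y = 1 - ∑ g ∈ F, (Γ k.1).indicator v g -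
      ∑ i ∈ (hN k).toFinset, if h : e i < e k then (if q i ∈ Γ k.1 then f i h else 0) else 0)
    fun k f => ⟨_, rfl⟩
  have hc' : ∀ k, c k = 1 - ∑ g ∈ F, (Γ k.1).indicator v g -
      ∑ i ∈ (hN k).toFinset, if q i ∈ Γ k.1 then c i else 0 := by
    intro k
    rw [hc k]
    congr 1
    refine Finset.sum_congr rfl fun i hi => ?_
    have hi' : e i < e k := (hN k).mem_toFinset.1 hi
    rw [dif_pos hi']
  have hc01 : ∀ k, 0 ≤ c k ∧ c k ≤ 1 := by
    intro k
    induction k using hwf.induction with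
    | _ k ih =>
      have hv0k : 0 ≤ ∑ g ∈ F, (Γ k.1).indicator v g :=
        Finset.sum_nonneg fun g _ => indicator_nonneg (fun g _ => hv0 g) g
      by_cases hex : ∃ i, e i < e k ∧ q i ∈ Γ k.1
      · obtain ⟨i, hi, hqi⟩ := hex
        have hik : i ≠ k := fun h => by simp [h] at hi
        have hs : (∑ i ∈ (hN k).toFinset, if q i ∈ Γ k.1 then c i else 0) = c i := by
          rw [Finset.sum_eq_single i, if_pos hqi]
          · intro j hj hji
            refine if_neg fun hqj => hji (hunique j i k (fun h => ?_) hik hqj hqi)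
            simp [h] at hj
          · intro h
            exact (h ((hN k).mem_toFinset.2 hi)).elim
        have hz : ∑ g ∈ F, (Γ k.1).indicator v g = 0 := by
          refine Finset.sum_eq_zero fun g hg => indicator_of_notMem (fun hgk => ?_) _
          exact (hq i).2.2.1 k.1 (fun h => hik (Subtype.ext h.symm)) ⟨g, hg, hgk⟩ hqi
        have := hc' k
        rw [hs, hz] at this
        constructor <;> linarith [(ih i hi).1, (ih i hi).2]
      · have hs : (∑ i ∈ (hN k).toFinset, if q i ∈ Γ k.1 then c i else 0) = 0 :=
          Finset.sum_eq_zero fun i hi =>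
            if_neg fun hqi => hex ⟨i, (hN k).mem_toFinset.1 hi, hqi⟩
        have := hc' k
        rw [hs] at this
        constructor <;> linarith [hv1 k.1]
  have hzrange : ∀ g, g ∉ range q → Function.extend q c (0 : X → ℝ) g = 0 := fun g hg =>
    Function.extend_apply' c (0 : X → ℝ) g fun ⟨i, hi⟩ => hg ⟨i, hi⟩
  have hz01 : ∀ g, 0 ≤ Function.extend q c (0 : X → ℝ) g ∧ Function.extend q c (0 : X → ℝ) g ≤ 1 := by
    intro g
    by_cases hg : g ∈ range q
    · obtain ⟨i, rfl⟩ := hg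
      rw [hqinj.extend_apply]
      exact hc01 i
    · rw [hzrange g hg]
      norm_num
  refine ⟨Function.extend q c (0 : X → ℝ), fun g => (hz01 g).1, fun g => (hz01 g).2, fun g hg => ?_,
    fun g => add_nonneg (hv0 g) (hz01 g).1, fun k => ?_⟩
  · refine hzrange g ?_
    rintro ⟨i, rfl⟩
    refine hg ?_
    rcases hb : col i with _ | _
    · exact Or.inr ⟨i, hb, rfl⟩
    · exact Or.inl ⟨i, hb, rfl⟩
  rw [hasSum_member_iff (w := v + Function.extend q c (0 : X → ℝ)), indicator_add']
  have h1 : HasSum ((Γ k).indicator v) (∑ g ∈ F, (Γ k).indicator v g) :=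
    hasSum_sum_of_ne_finset_zero fun g hg => by
      by_cases hgk : g ∈ Γ k <;> simp [hgk, hvF g hg]
  have h2 : (Γ k).indicator (Function.extend q c (0 : X → ℝ)) =
      Function.extend q (fun i => if q i ∈ Γ k then c i else 0) 0 := by
    funext g
    by_cases hg : g ∈ range q
    · obtain ⟨i, rfl⟩ := hg
      rw [hqinj.extend_apply]
      by_cases hik : q i ∈ Γ k <;> simp [hik, hqinj.extend_apply]
    · rw [Function.extend_apply' _ _ _ fun ⟨i, hi⟩ => hg ⟨i, hi⟩]
      by_cases hgk : g ∈ Γ k <;> simp [hgk, hzrange g hg]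
  rw [h2]
  by_cases hk : k ∈ M
  · have h3 : (fun i => if q i ∈ Γ k then c i else 0) = 0 :=
      funext fun i => if_neg ((hq i).2.1 k hk)
    rw [h3, ← hvM k hk]
    have h4 : Function.extend q (0 : {k // k ∉ M} → ℝ) 0 = (0 : X → ℝ) := by
      funext g
      by_cases hg : g ∈ range q
      · obtain ⟨i, rfl⟩ := hg
        rw [hqinj.extend_apply]
        rfl
      · exact Function.extend_apply' _ _ _ fun ⟨i, hi⟩ => hg ⟨i, hi⟩
    rw [h4, add_zero]
    exact h1
  · have h3 : HasSum (fun i => if q i ∈ Γ k then c i else 0)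
        (∑ i ∈ insert ⟨k, hk⟩ (hN ⟨k, hk⟩).toFinset, if q i ∈ Γ k then c i else 0) :=
      hasSum_sum_of_ne_finset_zero fun i hi => by
        refine if_neg fun hqi => hi ?_
        by_cases hik : i = ⟨k, hk⟩
        · exact hik ▸ Finset.mem_insert_self _ _
        · exact Finset.mem_insert_of_mem ((hN _).mem_toFinset.2 (hearlier i ⟨k, hk⟩ hik hqi))
    rw [Finset.sum_insert (by simp), if_pos (hq ⟨k, hk⟩).1] at h3
    have h4 := h1.add ((hasSum_extend_zero hqinj).2 h3)
    rw [hc' ⟨k, hk⟩] at h4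
    ring_nf at h4
    exact h4

/-! ### Extreme points of `S Γ` with prescribed support -/

theorem isCompact_S_inter_support (hunion : (⋃ k, Γ k) = univ) {D : Set X}
    (hD : ∀ k, (D ∩ Γ k).Finite) : IsCompact {u | u ∈ S Γ ∧ ∀ g ∉ D, u g = 0} := by
  have hsum : ∀ u : X → ℝ, (∀ g ∉ D, u g = 0) → ∀ k,
      HasSum (fun g : Γ k => u g) (∑ g ∈ (hD k).toFinset, u g) := by
    intro u hu k
    rw [hasSum_member_iff]
    have : ∑ g ∈ (hD k).toFinset, u g = ∑ g ∈ (hD k).toFinset, (Γ k).indicator u g :=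
      Finset.sum_congr rfl fun g hg => by
        rw [indicator_of_mem ((hD k).mem_toFinset.1 hg).2]
    rw [this]
    refine hasSum_sum_of_ne_finset_zero fun g hg => ?_
    by_cases hgk : g ∈ Γ k
    · rw [indicator_of_mem hgk]
      exact hu g fun hgD => hg ((hD k).mem_toFinset.2 ⟨hgD, hgk⟩)
    · exact indicator_of_notMem hgk _
  have hcl : IsClosed {u : X → ℝ | (∀ g, 0 ≤ u g) ∧ (∀ g, g ∉ D → u g = 0) ∧
      ∀ k, ∑ g ∈ (hD k).toFinset, u g = 1} := by
    simp only [Set.ofPred_and, Set.ofPred_forall]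
    refine (isClosed_iInter fun g => ?_).inter ((isClosed_iInter fun g => isClosed_iInter fun _ =>
      ?_).inter (isClosed_iInter fun k => ?_))
    · exact isClosed_le continuous_const (continuous_apply g)
    · exact isClosed_eq (continuous_apply g) continuous_const
    · exact isClosed_eq (continuous_finsetSum _ fun g _ => continuous_apply g) continuous_const
  have heq : {u | u ∈ S Γ ∧ ∀ g ∉ D, u g = 0} = {u : X → ℝ | (∀ g, 0 ≤ u g) ∧
      (∀ g, g ∉ D → u g = 0) ∧ ∀ k, ∑ g ∈ (hD k).toFinset, u g = 1} := by
    ext u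
    constructor
    · rintro ⟨hu, hD'⟩
      exact ⟨hu.1, hD', fun k => (hsum u hD' k).unique (hu.2 k)⟩
    · rintro ⟨h0, hD', h1⟩
      exact ⟨⟨h0, fun k => h1 k ▸ hsum u hD' k⟩, hD'⟩
  rw [← heq] at hcl
  refine (isCompact_univ_pi fun _ : X => isCompact_Icc (a := (0 : ℝ)) (b := 1)).of_isClosed_subset
    hcl ?_
  exact fun u hu g _ => ⟨hu.1.1 g, S.le_one hunion hu.1 g⟩

theorem isExtreme_S_inter_support (D : Set X) :
    IsExtreme ℝ (S Γ) {u | u ∈ S Γ ∧ ∀ g ∉ D, u g = 0} := by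
  refine ⟨fun u hu => hu.1, ?_⟩
  rintro x hx y hy z hz ⟨a, b, ha, hb, -, rfl⟩
  refine ⟨hx, fun g hg => ?_⟩
  have h := hz.2 g hg
  simp only [Pi.add_apply, Pi.smul_apply, smul_eq_mul] at h
  have h1 := mul_nonneg ha.le (hx.1 g)
  have h2 := mul_nonneg hb.le (hy.1 g)
  have h3 : a * x g = 0 := by linarith
  exact (mul_eq_zero.1 h3).resolve_left ha.ne'

/-- A finite linear functional attains on a compact face of `S Γ`, given by a restriction of the
support, its maximum at an extreme point of `S Γ`. -/
theorem exists_extremePoint_ge (hunion : (⋃ k, Γ k) = univ) {D : Set X}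
    (hD : ∀ k, (D ∩ Γ k).Finite) {u : X → ℝ} (hu : u ∈ S Γ) (huD : ∀ g ∉ D, u g = 0)
    (F : Finset X) (w' : X → ℝ) :
    ∃ v ∈ (S Γ).extremePoints ℝ, (∀ g ∉ D, v g = 0) ∧
      ∑ g ∈ F, u g * w' g ≤ ∑ g ∈ F, v g * w' g := by
  set K := {u | u ∈ S Γ ∧ ∀ g ∉ D, u g = 0}
  have hK : IsCompact K := isCompact_S_inter_support hunion hD
  let l : StrongDual ℝ (X → ℝ) := ∑ g ∈ F, w' g • ContinuousLinearMap.proj g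
  have hl : ∀ v, l v = ∑ g ∈ F, v g * w' g := fun v => by
    simp [l, mul_comm]
  have hexp : IsExposed ℝ K (l.toExposed K) := ContinuousLinearMap.toExposed.isExposed
  obtain ⟨x, hxK, hx⟩ := hK.exists_isMaxOn ⟨u, hu, huD⟩ l.continuous.continuousOn
  obtain ⟨v, hv⟩ := (hexp.isCompact hK).extremePoints_nonempty ⟨x, hxK, fun y hy => hx hy⟩
  have hvm : v ∈ l.toExposed K := extremePoints_subset hv
  refine ⟨v, (isExtreme_S_inter_support D).extremePoints_subset_extremePoints
    (hexp.isExtreme.extremePoints_subset_extremePoints hv), hvm.1.2, ?_⟩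
  rw [← hl, ← hl]
  exact hvm.2 u ⟨hu, huD⟩

theorem mem_extremePoints_SW {W : Submodule ℝ (X → ℝ)} {v : X → ℝ}
    (hv : v ∈ (S Γ).extremePoints ℝ) (hvW : v ∈ W) :
    (⟨v, hvW⟩ : W) ∈ (SW Γ W).extremePoints ℝ := by
  rw [mem_extremePoints] at hv ⊢
  refine ⟨hv.1, fun x hx y hy h => ?_⟩
  obtain ⟨a, b, ha, hb, hab, h⟩ := h
  have := hv.2 x hx y hy ⟨a, b, ha, hb, hab, congrArg Subtype.val h⟩
  exact ⟨Subtype.ext this.1, Subtype.ext this.2⟩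

/-! ### Approximation by extreme points -/

theorem IsPacking.indicator_mem {W : Submodule ℝ (X → ℝ)} (hP : P₀ Γ ⊆ (W : Set (X → ℝ)))
    {A : Set X} (hA : IsPacking Γ A) : A.indicator (fun _ => (1 : ℝ)) ∈ W :=
  hP hA.indicator_mem_P₀

theorem IsPacking.summable_indicator {W : Submodule ℝ (X → ℝ)} (hP : P₀ Γ ⊆ (W : Set (X → ℝ)))
    {w' : X → ℝ} (hw' : w' ∈ summableDual W) {A : Set X} (hA : IsPacking Γ A) :
    Summable (A.indicator fun g => |w' g|) := by
  refine (hw' _ (hA.indicator_mem hP)).congr fun g => ?_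
  by_cases hg : g ∈ A <;> simp [hg]

/-- A bounded function supported in the union of a finite set and two packings lies in every solid
space containing `P₀ Γ`. -/
theorem mem_of_support {W : Submodule ℝ (X → ℝ)} (hP : P₀ Γ ⊆ (W : Set (X → ℝ)))
    (hw : IsSolid W) {F : Finset X} {A B : Set X} (hA : IsPacking Γ A) (hB : IsPacking Γ B)
    {v : X → ℝ} (hv : ∀ g, |v g| ≤ 1) (hsupp : ∀ g ∉ (F : Set X) ∪ (A ∪ B), v g = 0) :
    v ∈ W := by
  classical
  let d : X → ℝ := ∑ x ∈ F, ({x} : Set X).indicator (fun _ => 1) +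
    (A.indicator (fun _ => 1) + B.indicator (fun _ => 1))
  have hd : d ∈ W := W.add_mem (W.sum_mem fun x _ => (isPacking_singleton x).indicator_mem hP)
    (W.add_mem (hA.indicator_mem hP) (hB.indicator_mem hP))
  have h0 : ∀ (s : Set X) (g : X), 0 ≤ s.indicator (fun _ => (1 : ℝ)) g := fun s =>
    indicator_nonneg fun _ _ => zero_le_one
  have hdval : ∀ g, d g = ∑ x ∈ F, ({x} : Set X).indicator (fun _ => (1 : ℝ)) g +
      (A.indicator (fun _ => 1) g + B.indicator (fun _ => 1) g) := fun g => by
    simp [d]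
  have hF0 : ∀ g, 0 ≤ ∑ x ∈ F, ({x} : Set X).indicator (fun _ => (1 : ℝ)) g := fun g =>
    Finset.sum_nonneg fun x _ => h0 _ g
  have hd0 : ∀ g, 0 ≤ d g := fun g => by
    rw [hdval]
    exact add_nonneg (hF0 g) (add_nonneg (h0 A g) (h0 B g))
  refine hw d hd v fun g => ?_
  rw [abs_of_nonneg (hd0 g)]
  by_cases hg : g ∈ (F : Set X) ∪ (A ∪ B)
  · refine (hv g).trans ?_
    rw [hdval]
    rcases hg with hg | hg | hg
    · have : (1 : ℝ) ≤ ∑ x ∈ F, ({x} : Set X).indicator (fun _ => (1 : ℝ)) g := by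
        refine le_trans ?_ (Finset.single_le_sum
          (f := fun x => ({x} : Set X).indicator (fun _ => (1 : ℝ)) g) (fun x _ => h0 _ g) hg)
        simp
      linarith [h0 A g, h0 B g]
    · have := indicator_of_mem hg (fun _ => (1 : ℝ))
      linarith [hF0 g, h0 B g]
    · have := indicator_of_mem hg (fun _ => (1 : ℝ))
      linarith [hF0 g, h0 A g]
  · rw [hsupp g hg, abs_zero]
    exact hd0 g

/-- Every element of `S Γ` that lies in `W` is approximated from below, in the pairing with an
element of the summable dual, by extreme points of `S(Γ, W)`. -/
theorem exists_extremePoint_SW_pairing_ge [Countable ι] (hunion : (⋃ k, Γ k) = univ)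
    {W : Submodule ℝ (X → ℝ)} (hP : P₀ Γ ⊆ (W : Set (X → ℝ))) (ha : PointFinite Γ)
    (hW : IsSolid W) (ha₂ : CoverCondition Γ) {w' : X → ℝ} (hw' : w' ∈ summableDual W)
    {w : W} (hw : w ∈ SW Γ W) {ε : ℝ} (hε : 0 < ε) :
    ∃ v ∈ (SW Γ W).extremePoints ℝ,
      ∑' g, (w : X → ℝ) g * w' g - ε ≤ ∑' g, (v : X → ℝ) g * w' g := by
  classical
  obtain ⟨M, hM⟩ := ha₂.exists_finset ha hw
  -- `ε / 5` is lost in the truncation, and `ε / 5` for each of the two packings both in the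
  -- completion and in passing from sums over `F` to the full pairing
  obtain ⟨J, hJ⟩ := exists_finset_packing_tsum_le hunion ha (f := fun g => |w' g|)
    (fun A hA => hA.summable_indicator hP hw') (by linarith : 0 < ε / 5)
  obtain ⟨F, v₀, hv0, hvF, hv1, hvM, hvw⟩ :=
    S.exists_truncation ha hw (M ∪ J) (hw' w w.2) (by linarith : 0 < ε / 5)
  obtain ⟨A, hA, hAM, hAd, hcompl⟩ := exists_completion ha (M ∪ J)
    (fun k hk => hM k fun h => hk (Finset.mem_union_left _ h)) F
  obtain ⟨z, hz0, hz1, hzA, hzS⟩ := hcompl v₀ hv0 hvF hv1 hvM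
  set Q := A true ∪ A false with hQ
  have hAs := fun b => (hA b).summable_indicator hP hw'
  have hQind : Q.indicator (fun g => |w' g|) =
      fun g => (A true).indicator (fun g => |w' g|) g + (A false).indicator (fun g => |w' g|) g :=
    indicator_union_of_disjoint hAd _
  have hQs : Summable (Q.indicator fun g => |w' g|) := by
    rw [hQind]
    exact (hAs true).add (hAs false)
  have hQle : ∑' g, Q.indicator (fun g => |w' g|) g ≤ ε / 5 + ε / 5 := by
    rw [hQind, (hAs true).tsum_add (hAs false)]
    exact add_le_add
      (hJ _ (hA true) fun j hj => hAM true j (Finset.mem_union_right _ hj))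
      (hJ _ (hA false) fun j hj => hAM false j (Finset.mem_union_right _ hj))
  -- functions with values in `[-1, 1]` supported in `Q` have small pairing with `w'`
  have hsmall : ∀ y : X → ℝ, (∀ g, |y g| ≤ 1) → (∀ g ∉ Q, y g = 0) → ∀ G : Finset X,
      -(ε / 5 + ε / 5) ≤ ∑ g ∈ G, y g * w' g := by
    intro y hy hyQ G
    have h1 : |∑ g ∈ G, y g * w' g| ≤ ∑ g ∈ G, Q.indicator (fun g => |w' g|) g := by
      refine (Finset.abs_sum_le_sum_abs _ _).trans (Finset.sum_le_sum fun g _ => ?_)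
      by_cases hg : g ∈ Q
      · rw [indicator_of_mem hg, abs_mul]
        exact mul_le_of_le_one_left (abs_nonneg _) (hy g)
      · simp [hg, hyQ g hg]
    have h2 := hQs.sum_le_tsum G fun g _ => indicator_nonneg (fun g _ => abs_nonneg (w' g)) g
    exact (abs_le.1 (h1.trans (h2.trans hQle))).1
  have hD : ∀ k, (((F : Set X) ∪ Q) ∩ Γ k).Finite := by
    intro k
    rw [hQ, union_inter_distrib_right, union_inter_distrib_right]
    exact (F.finite_toSet.inter_of_left _).union ((hA true k).finite.union (hA false k).finite)
  obtain ⟨v, hvext, hvsupp, hvge⟩ := exists_extremePoint_ge hunion hD hzS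
    (fun g hg => by
      have h1 : v₀ g = 0 := hvF g fun h => hg (Or.inl h)
      have h2 : z g = 0 := hzA g fun h => hg (Or.inr h)
      simp [h1, h2]) F w'
  have hvabs : ∀ g, |v g| ≤ 1 := fun g => by
    rw [abs_of_nonneg (hvext.1.1 g)]
    exact S.le_one hunion hvext.1 g
  have hvW : v ∈ W := mem_of_support hP hW (hA true) (hA false) hvabs hvsupp
  refine ⟨⟨v, hvW⟩, mem_extremePoints_SW hvext hvW, ?_⟩
  have hz : -(ε / 5 + ε / 5) ≤ ∑ g ∈ F, z g * w' g :=
    hsmall z (fun g => by rw [abs_of_nonneg (hz0 g)]; exact hz1 g) hzA F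
  have hsplit : ∑ g ∈ F, (v₀ + z) g * w' g = ∑ g ∈ F, v₀ g * w' g + ∑ g ∈ F, z g * w' g := by
    rw [← Finset.sum_add_distrib]
    exact Finset.sum_congr rfl fun g _ => by rw [Pi.add_apply, add_mul]
  have htail : ∑ g ∈ F, v g * w' g - (ε / 5 + ε / 5) ≤ ∑' g, v g * w' g := by
    refine ge_of_tendsto (hw' v hvW).of_abs.hasSum ?_
    filter_upwards [Filter.eventually_ge_atTop F] with G hG
    have h1 := hsmall (fun g => if g ∈ F then 0 else v g)
      (fun g => by split_ifs; exacts [by simp, hvabs g])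
      (fun g hg => by
        split_ifs with h
        · rfl
        · exact hvsupp g fun h' => h'.elim h hg) G
    have h2 : ∑ g ∈ G, v g * w' g =
        ∑ g ∈ F, v g * w' g + ∑ g ∈ G, (if g ∈ F then 0 else v g) * w' g := by
      have h3 : ∑ g ∈ F, v g * w' g = ∑ g ∈ G, if g ∈ F then v g * w' g else 0 := by
        rw [Finset.sum_ite_mem, Finset.inter_eq_right.2 hG]
      rw [h3, ← Finset.sum_add_distrib]
      refine Finset.sum_congr rfl fun g _ => ?_
      split_ifs <;> simp
    linarith
  linarith

/-! ### Locally convex topologies -/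

theorem exists_topDual_separating {V : Type*} [AddCommGroup V] [Module ℝ V]
    {T : TopologicalSpace V} (hT : IsLocallyConvexTopology T) {A : Set V} {x : V}
    (hx : x ∉ closedHullExtreme T A) :
    ∃ φ ∈ topDual T, ∃ c : ℝ, (∀ a ∈ A.extremePoints ℝ, φ a < c) ∧ c < φ x := by
  have := hT.isTopologicalAddGroup
  have := hT.continuousSMul
  have := hT.locallyConvexSpace
  obtain ⟨f, c, hf, hfx⟩ := geometric_hahn_banach_closed_point
    (convex_convexHull ℝ (A.extremePoints ℝ)).closure isClosed_closure hx
  exact ⟨f.toLinearMap, f.continuous, c,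
    fun a ha => hf a (subset_closure (subset_convexHull ℝ _ ha)), hfx⟩

theorem closedHullExtreme_subset {V : Type*} [AddCommGroup V] [Module ℝ V]
    {T : TopologicalSpace V} {A B : Set V} (hAB : A ⊆ B) (hB : Convex ℝ B) (hcl : IsClosed B) :
    closedHullExtreme T A ⊆ B :=
  closure_minimal (convexHull_min (extremePoints_subset.trans hAB) hB) hcl

theorem isClosed_setOf_eq_of_mem_topDual {V : Type*} [AddCommGroup V] [Module ℝ V]
    {T : TopologicalSpace V} {φ : V →ₗ[ℝ] ℝ} (hφ : φ ∈ topDual T) (c : ℝ) :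
    IsClosed {v | φ v = c} :=
  isClosed_singleton.preimage hφ

theorem convex_nonnegCone (W : Submodule ℝ (X → ℝ)) : Convex ℝ (nonnegCone W) := by
  intro x hx y hy a b ha hb _ g
  exact add_nonneg (mul_nonneg ha (hx g)) (mul_nonneg hb (hy g))

theorem SW_subset_closedHullExtreme [Countable ι] (hunion : (⋃ k, Γ k) = univ)
    {W : Submodule ℝ (X → ℝ)} (hP : P₀ Γ ⊆ (W : Set (X → ℝ))) (ha : PointFinite Γ)
    (hW : IsSolid W) (ha₂ : CoverCondition Γ) {T : TopologicalSpace W}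
    (hT : IsLocallyConvexTopology T) (hw₁ : DualInSummable W T) :
    SW Γ W ⊆ closedHullExtreme T (SW Γ W) := by
  intro w hw
  by_contra hcon
  obtain ⟨φ, hφ, c, hφc, hcw⟩ := exists_topDual_separating hT hcon
  obtain ⟨w', hw', hrep⟩ := hw₁ φ hφ
  obtain ⟨v, hv, hvw⟩ := exists_extremePoint_SW_pairing_ge hunion hP ha hW ha₂ hw' hw
    (sub_pos.2 hcw)
  rw [← hrep, ← hrep] at hvw
  linarith [hφc v hv]

theorem closedHullExtreme_inter_nonnegCone_subset {W : Submodule ℝ (X → ℝ)}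
    {T : TopologicalSpace W} (hw₂ : DualHasSums Γ W T) :
    closedHullExtreme T (SW Γ W) ∩ nonnegCone W ⊆ SW Γ W := by
  rintro w ⟨hw, hw0⟩
  refine ⟨hw0, fun k => ?_⟩
  obtain ⟨φ, hφ, hsum⟩ := hw₂ k
  have hsub : closedHullExtreme T (SW Γ W) ⊆ {v | φ v = 1} :=
    closedHullExtreme_subset (fun v hv => (hsum v).unique (hv.2 k))
      (convex_hyperplane φ.isLinear 1) (isClosed_setOf_eq_of_mem_topDual hφ 1)
  have h1 : φ w = 1 := hsub hw
  exact h1 ▸ hsum w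

end Birkhoff

theorem theorem3p3 {X ι : Type*} [Countable ι] (Γ : ι → Set X)
    (hcountable : ∀ k, (Γ k).Countable) (hunion : (⋃ k, Γ k) = Set.univ)
    (W : Submodule ℝ (X → ℝ)) (hP : Birkhoff.P₀ Γ ⊆ (W : Set (X → ℝ)))
    (ha : Birkhoff.PointFinite Γ) (hw : Birkhoff.IsSolid W)
    (ha₂ : Birkhoff.CoverCondition Γ)
    (T : TopologicalSpace W) (hT : Birkhoff.IsLocallyConvexTopology T)
    (hw₁ : Birkhoff.DualInSummable W T) (hw₂ : Birkhoff.DualHasSums Γ W T) :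
    Birkhoff.SW Γ W =
        Birkhoff.closedHullExtreme T (Birkhoff.SW Γ W) ∩ Birkhoff.nonnegCone W ∧
      (@IsClosed W T (Birkhoff.nonnegCone W) →
        Birkhoff.SW Γ W = Birkhoff.closedHullExtreme T (Birkhoff.SW Γ W)) ∧
      ((∀ g : X, @Continuous W ℝ T _ (fun w : W => (w : X → ℝ) g)) →
        Birkhoff.SW Γ W = Birkhoff.closedHullExtreme T (Birkhoff.SW Γ W)) := by
  have hsub := Birkhoff.SW_subset_closedHullExtreme hunion hP ha hw ha₂ hT hw₁
  have hcone : Birkhoff.SW Γ W ⊆ Birkhoff.nonnegCone W := fun w hw => hw.1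
  have hmain : Birkhoff.SW Γ W =
      Birkhoff.closedHullExtreme T (Birkhoff.SW Γ W) ∩ Birkhoff.nonnegCone W :=
    (subset_inter hsub hcone).antisymm (Birkhoff.closedHullExtreme_inter_nonnegCone_subset hw₂)
  have hclosed : @IsClosed W T (Birkhoff.nonnegCone W) →
      Birkhoff.SW Γ W = Birkhoff.closedHullExtreme T (Birkhoff.SW Γ W) := fun hcl =>
    hmain.trans (inter_eq_left.2
      (Birkhoff.closedHullExtreme_subset hcone (Birkhoff.convex_nonnegCone W) hcl))
  refine ⟨hmain, hclosed, fun hev => hclosed ?_⟩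
  have : Birkhoff.nonnegCone W = ⋂ g : X, {w : W | 0 ≤ (w : X → ℝ) g} := by
    ext w
    simp [Birkhoff.nonnegCone]
  rw [this]
  exact @isClosed_iInter _ _ T _ fun g => @IsClosed.preimage _ _ T _ _ (hev g) _ isClosed_Ici
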